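/- Let $D$ be the open unit disc of $\mathbb{C}$. For real numbers $a<b$ and $0<p<\infty$ let $H^p_{[a,b]}$ be the space of holomorphic functions $f$ on $D$ with $\sup_{0<r<1}\int_a^b|f(re^{i\theta})|^p\,d\theta<\infty$, let $H^\infty_{[a,b]}$ be the space of holomorphic functions $f$ on $D$ with $\sup_{0<r<1}\sup_{a\le\theta\le b}|f(re^{i\theta})|<\infty$, and let $H^p=H^p_{[0,2\pi]}$ for $0<p\le\infty$. For $0<p<\infty$ the space $H^p$ carries the metric $d_p(f,g)=\bigl(\sup_{0<r<1}\int_0^{2\pi}|f(re^{i\theta})-g(re^{i\theta})|^p\,d\theta\bigr)^{\min(1,1/p)}$, and for $0<p\le\infty$ the space $\bigcap_{0<\beta<p}H^\beta$ carries the coarsest topology for which its inclusions into all the spaces $H^\beta$, $0<\beta<p$, are continuous. **Theorem B.** Let $0<p\le q\le\infty$ and let $a<b$ be real numbers. Then $$\Bigl(\bigcap_{0<\beta<p}H^\beta\setminus H^q_{[a,b]}\Bigr)\cup\{0\}$$ contains a (complex) vector space that is dense in $\bigcap_{0<\beta<p}H^\beta$. If moreover $p<q$, then $(H^p\setminus H^q_{[a,b]})\cup\{0\}$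 contains a (complex) vector space that is dense in $H^p$. -/

import Mathlib

open MeasureTheory Set
open scoped ENNReal Complex.UnitDisc

noncomputable section

namespace HardyChain

/-- The space of holomorphic functions on the open unit disc `𝔻`. A function on `𝔻` is holomorphic
iff it is the restriction to the disc of a function on `ℂ` that is complex differentiable at every
point of the open disc (its values off the disc are irrelevant). -/
def holo : Submodule ℂ (𝔻 → ℂ) where
  carrier := {f | ∃ F : ℂ → ℂ, DifferentiableOn ℂ F (Metric.ball 0 1) ∧ ∀ z : 𝔻, F z = f z}
  zero_mem' := ⟨0, differentiableOn_const 0, fun _ => rfl⟩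
  add_mem' := by
    rintro f g ⟨F, hF, hf⟩ ⟨G, hG, hg⟩
    exact ⟨F + G, hF.add hG, fun z => by simp [hf, hg]⟩
  smul_mem' := by
    rintro c f ⟨F, hF, hf⟩
    exact ⟨c • F, hF.const_smul c, fun z => by simp [hf]⟩

/-- The point `r e^{iθ}` of the unit disc, for a radius `0 < r < 1`. -/
def circlePt (r : Ioo (0 : ℝ) 1) (θ : ℝ) : 𝔻 :=
  Complex.UnitDisc.mk ((r : ℝ) * Complex.exp (θ * Complex.I)) (by
    rw [norm_mul, Complex.norm_exp_ofReal_mul_I, mul_one, Complex.norm_real, Real.norm_eq_abs,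
      abs_of_pos r.2.1]
    exact r.2.2)

/-- The size of `f` on the sector `a ≤ θ ≤ b`, as an element of `[0, ∞]`:
`sup_{0<r<1} ∫_a^b |f(r e^{iθ})|^p dθ` for finite `p`, and
`sup_{0<r<1} sup_{a≤θ≤b} |f(r e^{iθ})|` for `p = ∞`. -/
def sectorSize (p : ℝ≥0∞) (a b : ℝ) (f : 𝔻 → ℂ) : ℝ≥0∞ :=
  if p = ∞ then ⨆ r : Ioo (0 : ℝ) 1, ⨆ θ ∈ Icc a b, ‖f (circlePt r θ)‖ₑ
  else ⨆ r : Ioo (0 : ℝ) 1, ∫⁻ θ in Icc a b, ‖f (circlePt r θ)‖ₑ ^ p.toReal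

lemma continuous_circle {f : 𝔻 → ℂ} (hf : f ∈ holo) (r : Ioo (0 : ℝ) 1) :
    Continuous fun θ => f (circlePt r θ) := by
  obtain ⟨F, hF, hf⟩ := hf
  have h : (fun θ => f (circlePt r θ)) = fun θ => F (circlePt r θ : ℂ) := by
    funext θ; rw [hf]
  rw [h]
  refine hF.continuousOn.comp_continuous ?_ fun θ => (circlePt r θ).2
  change Continuous fun θ : ℝ => ((r : ℝ) : ℂ) * Complex.exp (θ * Complex.I)
  fun_prop

lemma measurable_circle {f : 𝔻 → ℂ} (hf : f ∈ holo) (r : Ioo (0 : ℝ) 1) :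
    Measurable fun θ => ‖f (circlePt r θ)‖ₑ :=
  (continuous_circle hf r).enorm.measurable

/-- Subadditivity of `sectorSize ^ (1 / max 1 p)` (of `sectorSize` itself if `p = ∞`, since then
`p.toReal = 0`). -/
lemma sectorSize_add_le (p : ℝ≥0∞) (a b : ℝ) {f g : 𝔻 → ℂ} (hf : f ∈ holo) (hg : g ∈ holo) :
    sectorSize p a b (f + g) ^ (max 1 p.toReal)⁻¹ ≤
      sectorSize p a b f ^ (max 1 p.toReal)⁻¹ + sectorSize p a b g ^ (max 1 p.toReal)⁻¹ := by
  have hm : (0 : ℝ) < max 1 p.toReal := lt_of_lt_of_le one_pos (le_max_left _ _)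
  unfold sectorSize
  split_ifs with hp
  · simp only [hp, ENNReal.toReal_top, max_eq_left zero_le_one, inv_one, ENNReal.rpow_one]
    refine iSup_le fun r => iSup₂_le fun θ hθ => (enorm_add_le _ _).trans (add_le_add ?_ ?_)
    · exact le_iSup_of_le r (le_iSup₂_of_le θ hθ le_rfl)
    · exact le_iSup_of_le r (le_iSup₂_of_le θ hθ le_rfl)
  · rw [ENNReal.rpow_inv_le_iff hm]
    refine iSup_le fun r => ?_
    rw [← ENNReal.rpow_inv_le_iff hm]
    refine le_trans ?_ (add_le_add
      (ENNReal.rpow_le_rpow (le_iSup (fun r : Ioo (0 : ℝ) 1 =>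
        ∫⁻ θ in Icc a b, ‖f (circlePt r θ)‖ₑ ^ p.toReal) r) (inv_nonneg.2 hm.le))
      (ENNReal.rpow_le_rpow (le_iSup (fun r : Ioo (0 : ℝ) 1 =>
        ∫⁻ θ in Icc a b, ‖g (circlePt r θ)‖ₑ ^ p.toReal) r) (inv_nonneg.2 hm.le)))
    have hle : ∫⁻ θ in Icc a b, ‖(f + g) (circlePt r θ)‖ₑ ^ p.toReal ≤
        ∫⁻ θ in Icc a b, (‖f (circlePt r θ)‖ₑ + ‖g (circlePt r θ)‖ₑ) ^ p.toReal :=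
      lintegral_mono fun θ => ENNReal.rpow_le_rpow (enorm_add_le _ _) ENNReal.toReal_nonneg
    refine (ENNReal.rpow_le_rpow hle (inv_nonneg.2 hm.le)).trans ?_
    rcases le_total p.toReal 1 with h1 | h1
    · simp only [max_eq_left h1, inv_one, ENNReal.rpow_one]
      rw [← lintegral_add_left ((measurable_circle hf r).pow_const _)]
      exact lintegral_mono fun θ =>
        ENNReal.rpow_add_le_add_rpow _ _ ENNReal.toReal_nonneg h1
    · simp only [max_eq_right h1, ← one_div]
      exact ENNReal.lintegral_Lp_add_le (measurable_circle hf r).aemeasurable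
        (measurable_circle hg r).aemeasurable h1

lemma sectorSize_zero {p : ℝ≥0∞} (hp : 0 < p) (a b : ℝ) : sectorSize p a b 0 = 0 := by
  unfold sectorSize
  split_ifs with h
  · simp
  · simp [ENNReal.zero_rpow_of_pos (ENNReal.toReal_pos hp.ne' h)]

lemma sectorSize_zero_lt_top (p : ℝ≥0∞) (a b : ℝ) : sectorSize p a b 0 < ∞ := by
  rcases eq_or_ne p 0 with rfl | hp
  · exact lt_of_le_of_lt (b := ENNReal.ofReal (b - a)) (by simp [sectorSize]) ENNReal.ofReal_lt_top
  · simp [sectorSize_zero (pos_iff_ne_zero.2 hp)]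

lemma sectorSize_smul_lt_top (p : ℝ≥0∞) (a b : ℝ) (c : ℂ) {f : 𝔻 → ℂ} (h : sectorSize p a b f < ∞) :
    sectorSize p a b (c • f) < ∞ := by
  unfold sectorSize at h ⊢
  split_ifs at h ⊢ with hp
  · simp only [Pi.smul_apply, enorm_smul, ← ENNReal.mul_iSup]
    exact ENNReal.mul_lt_top enorm_lt_top h
  · have hc : ‖c‖ₑ ^ p.toReal ≠ ∞ :=
      ENNReal.rpow_ne_top_of_nonneg ENNReal.toReal_nonneg enorm_ne_top
    simp only [Pi.smul_apply, enorm_smul, ENNReal.mul_rpow_of_nonneg _ _ ENNReal.toReal_nonneg,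
      lintegral_const_mul' _ _ hc, ← ENNReal.mul_iSup]
    exact ENNReal.mul_lt_top hc.lt_top h

/-- The localised Hardy space `H^p_{[a,b]}`. -/
def localHardy (p : ℝ≥0∞) (a b : ℝ) : Submodule ℂ (𝔻 → ℂ) where
  carrier := {f | f ∈ holo ∧ sectorSize p a b f < ∞}
  zero_mem' := ⟨holo.zero_mem, sectorSize_zero_lt_top p a b⟩
  add_mem' := by
    rintro f g ⟨hf, hf'⟩ ⟨hg, hg'⟩
    have hm : (0 : ℝ) < (max 1 p.toReal)⁻¹ :=
      inv_pos.2 (lt_of_lt_of_le one_pos (le_max_left _ _))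
    refine ⟨holo.add_mem hf hg, (ENNReal.rpow_lt_top_iff_of_pos hm).1 ?_⟩
    exact (sectorSize_add_le p a b hf hg).trans_lt (ENNReal.add_lt_top.2
      ⟨(ENNReal.rpow_lt_top_iff_of_pos hm).2 hf', (ENNReal.rpow_lt_top_iff_of_pos hm).2 hg'⟩)
  smul_mem' := fun c _ hf => ⟨holo.smul_mem c hf.1, sectorSize_smul_lt_top p a b c hf.2⟩

/-- The Hardy space `H^p` of the unit disc. -/
def hardy (p : ℝ≥0∞) : Submodule ℂ (𝔻 → ℂ) := localHardy p 0 (2 * Real.pi)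

/-- The distance of `H^p`: `sup_r ∫_0^{2π} |f - g|^p dθ` for `0 < p ≤ 1`,
`(sup_r ∫_0^{2π} |f - g|^p dθ)^{1/p}` for `1 ≤ p < ∞`, and `sup_𝔻 |f - g|` for `p = ∞`
(the exponent is `1` in that case, because `(∞ : ℝ≥0∞).toReal = 0`). -/
def hardyDist (p : ℝ≥0∞) (f g : 𝔻 → ℂ) : ℝ≥0∞ :=
  sectorSize p 0 (2 * Real.pi) (f - g) ^ (max 1 p.toReal)⁻¹

/-- `H^p` with its distance. -/
abbrev hardyMetric (p : ℝ≥0∞) (hp : 0 < p) : PseudoEMetricSpace (hardy p) where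
  edist f g := hardyDist p f g
  edist_self f := by
    have hm : (0 : ℝ) < (max 1 p.toReal)⁻¹ :=
      inv_pos.2 (lt_of_lt_of_le one_pos (le_max_left _ _))
    simp [hardyDist, sectorSize_zero hp, ENNReal.zero_rpow_of_pos hm]
  edist_comm f g := by
    simp only [hardyDist, sectorSize, Pi.sub_apply]
    simp only [enorm_sub_rev]
  edist_triangle f g h := by
    have := sectorSize_add_le p 0 (2 * Real.pi) (holo.sub_mem f.2.1 g.2.1) (holo.sub_mem g.2.1 h.2.1)
    rwa [sub_add_sub_cancel] at this

/-- The natural topology of `H^p`, `0 < p ≤ ∞`. -/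
abbrev hardyTopology (p : ℝ≥0∞) (hp : 0 < p) : TopologicalSpace (hardy p) :=
  (hardyMetric p hp).toUniformSpace.toTopologicalSpace

/-- The space `⋂_{0 < β < p} H^β`. -/
def hardyInter (p : ℝ≥0∞) : Submodule ℂ (𝔻 → ℂ) := ⨅ β : Ioo 0 p, hardy β

lemma hardyInter_le (p : ℝ≥0∞) (β : Ioo 0 p) : hardyInter p ≤ hardy β := iInf_le _ β

/-- The natural topology of `⋂_{0 < β < p} H^β`: the coarsest one for which the inclusions into
all the spaces `H^β`, `0 < β < p`, are continuous. -/
abbrev hardyInterTopology (p : ℝ≥0∞) : TopologicalSpace (hardyInter p) :=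
  ⨅ β : Ioo 0 p, (hardyTopology β β.2.1).induced (Submodule.inclusion (hardyInter_le p β))

end HardyChain

end

open HardyChain

open Filter Topology

namespace HardyChain

/-! The function `peak q t` has one boundary singularity, at e^{it}, just too strong for H^q. It
lies in H^β for every β < q, with bounds uniform for t in a bounded set
(`exists_sectorSize_peak_le`), but it fails H^q on every sector around its singularity
(`peak_notMem_localHardy`). Distinct singularities cannot cancel one another, so these functions are
linearly independent modulo H^q_{[a,b]} (`eq_zero_of_sum_peak_mem`).

Density comes from linear algebra (`exists_dense_disjoint`). The whole set X × ℕ, X being the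
ambient space, serves as index set; it embeds in an interval of singularities because X has at most
continuum many elements (`exists_embedding_Ioo`). The peak with index (y, n) is perturbed by (n + 1)
times a correction of y that does not affect independence modulo W. Dividing by n + 1 makes the peak
negligible and leaves y, which is enough to reach every vector. -/

/-! ### Dense subspaces from families independent modulo a subspace -/

/-- If `u : X × ℕ → X` is linearly independent modulo `W` and uniformly bounded (in the sense that
`u (y, n) / (n + 1) → 0`), then a dense subspace of `X` meets `W` only in zero. -/
theorem exists_dense_disjoint {X : Type*} [AddCommGroup X] [Module ℂ X] [TopologicalSpace X]
    (W : Submodule ℂ X) (u : X × ℕ → X)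
    (hu : ∀ l : (X × ℕ) →₀ ℂ, Finsupp.linearCombination ℂ u l ∈ W → l = 0)
    (hlim : ∀ x y : X,
      Tendsto (fun n : ℕ => x + ((n : ℂ) + 1)⁻¹ • u (y, n)) atTop (𝓝 x)) :
    ∃ V : Submodule ℂ X, Disjoint V W ∧ Dense (V : Set X) := by
  classical
  set S := Finsupp.linearCombination ℂ u with hS
  obtain ⟨g, hg⟩ := (W.mkQ ∘ₗ S).exists_leftInverse_of_injective (by
    rw [LinearMap.ker_eq_bot']
    intro l hl
    exact hu l ((Submodule.Quotient.mk_eq_zero W).1 hl))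
  set π := g ∘ₗ W.mkQ with hπ
  have hπW : ∀ w ∈ W, π w = 0 := fun w hw => by
    simp [hπ, (Submodule.Quotient.mk_eq_zero W).2 hw]
  have hπS : ∀ l, π (S l) = l := fun l => LinearMap.congr_fun hg l
  -- Subtracting `S (π i.1)` puts the second summand in the kernel of `π`, so `π` still recovers the
  -- coefficients; hence the range of `L` meets `W` only in zero.
  set L : ((X × ℕ) →₀ ℂ) →ₗ[ℂ] X := Finsupp.linearCombination ℂ
    (fun i : X × ℕ => u i + ((i.2 : ℂ) + 1) • (i.1 - S (π i.1))) with hL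
  have hπL : ∀ l, π (L l) = l := by
    intro l
    have : π ∘ₗ L = LinearMap.id := by
      ext i : 2
      have h1 : π (u i) = Finsupp.single i 1 := by
        rw [← hπS (Finsupp.single i 1)]
        simp [hS]
      simp [hL, h1, hπS]
    exact LinearMap.congr_fun this l
  refine ⟨LinearMap.range L, ?_, ?_⟩
  · rw [Submodule.disjoint_def]
    rintro _ ⟨l, rfl⟩ hl
    rw [← hπL l, hπW _ hl, map_zero]
  · intro x
    -- The index `y` is adapted to `x`: as `π y = 0`, the correction in `L` vanishes and the
    -- approximants become exactly `x + (n + 1)⁻¹ • u (y, n)`.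
    set y := x - L (π x) with hy
    have hπy : π y = 0 := by simp [hy, hπL]
    refine mem_closure_of_tendsto (hlim x y) (Eventually.of_forall fun n => ?_)
    refine ⟨π x + ((n : ℂ) + 1)⁻¹ • Finsupp.single (y, n) 1, ?_⟩
    have hn : ((n : ℂ) + 1) ≠ 0 := Nat.cast_add_one_ne_zero n
    have h2 : L (Finsupp.single (y, n) 1) = u (y, n) + ((n : ℂ) + 1) • y := by
      simp [hL, hπy]
    rw [map_add, map_smul, h2, smul_add, smul_smul, inv_mul_cancel₀ hn, one_smul, hy]
    abel

/-! ### Cardinality of spaces of holomorphic functions -/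

lemma continuous_of_mem_holo {f : 𝔻 → ℂ} (hf : f ∈ holo) : Continuous f := by
  obtain ⟨F, hF, hf⟩ := hf
  rw [show f = fun z : 𝔻 => F z from funext fun z => (hf z).symm]
  exact hF.continuousOn.comp_continuous Complex.UnitDisc.continuous_coe fun z => z.2

instance : SecondCountableTopology 𝔻 :=
  Complex.UnitDisc.isEmbedding_coe.secondCountableTopology

/-- A continuous function is determined by its values on a countable dense set, and ℂ^ℕ has the
cardinality of the continuum. -/
lemma mk_le_continuum (H : Submodule ℂ (𝔻 → ℂ)) (hH : H ≤ holo) :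
    Cardinal.mk H ≤ Cardinal.continuum := by
  have hinj : Function.Injective
      (fun (f : H) (n : ℕ) => (f : 𝔻 → ℂ) (TopologicalSpace.denseSeq 𝔻 n)) := by
    intro f g hfg
    refine Subtype.ext ((continuous_of_mem_holo (hH f.2)).ext_on
      (TopologicalSpace.denseRange_denseSeq 𝔻) (continuous_of_mem_holo (hH g.2)) ?_)
    rintro _ ⟨n, rfl⟩
    exact congrFun hfg n
  refine (Cardinal.mk_le_of_injective hinj).trans ?_
  simp

lemma exists_embedding_Ioo (H : Submodule ℂ (𝔻 → ℂ)) (hH : H ≤ holo) {a b : ℝ} (hab : a < b) :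
    Nonempty (H × ℕ ↪ Ioo a b) := by
  rw [← Cardinal.le_def, Cardinal.mk_Ioo_real hab]
  simp only [Cardinal.mk_prod, Cardinal.lift_uzero, Cardinal.mk_nat]
  exact (mul_le_mul_left (mk_le_continuum H hH) _).trans
    (by simp)

/-! ### The singular functions and their pointwise size -/

/-- A function with a singularity at `0` that lies just outside the `q`-integrable range:
`log w` if `q = ∞` and `w ^ (-1 / q)` otherwise. -/
noncomputable def branch (q : ℝ≥0∞) (w : ℂ) : ℂ :=
  if q = ∞ then Complex.log w else w ^ ((-(q.toReal)⁻¹ : ℝ) : ℂ)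

/-- The function `branch q`, transported to the unit disc with its singularity at `e^{it}`. -/
noncomputable def peak (q : ℝ≥0∞) (t : ℝ) (z : 𝔻) : ℂ :=
  branch q (1 - Complex.exp (-(t * Complex.I)) * z)

lemma norm_exp_neg_mul_I (t : ℝ) : ‖Complex.exp (-(t * Complex.I))‖ = 1 := by
  rw [← neg_mul, ← Complex.ofReal_neg, Complex.norm_exp_ofReal_mul_I]

lemma re_one_sub_pos {w : ℂ} (hw : ‖w‖ < 1) : 0 < (1 - w).re := by
  have := (Complex.abs_re_le_norm w).trans_lt hw
  simp only [Complex.sub_re, Complex.one_re]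
  linarith [le_abs_self w.re]

lemma peak_mem_holo (q : ℝ≥0∞) (t : ℝ) : peak q t ∈ holo := by
  refine ⟨fun z => branch q (1 - Complex.exp (-(t * Complex.I)) * z), ?_, fun z => rfl⟩
  have h1 : DifferentiableOn ℂ (fun z : ℂ => 1 - Complex.exp (-(t * Complex.I)) * z)
      (Metric.ball 0 1) := by fun_prop
  have h2 : ∀ z ∈ Metric.ball (0 : ℂ) 1,
      1 - Complex.exp (-(t * Complex.I)) * z ∈ Complex.slitPlane := by
    intro z hz
    refine Or.inl (re_one_sub_pos ?_)
    rw [norm_mul, norm_exp_neg_mul_I, one_mul]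
    simpa using hz
  unfold branch
  split_ifs
  · exact h1.clog h2
  · exact h1.cpow (differentiableOn_const _) h2

/-- A single power bound covers both cases: s = 1/q for finite q, while for the logarithm any small
power will do, here with sβ = 1/2. -/
lemma exists_branch_bound {q β : ℝ≥0∞} (hβ : 0 < β) (hβq : β < q) :
    ∃ s C : ℝ, 0 ≤ s ∧ 0 ≤ C ∧ s * β.toReal < 1 ∧
      ∀ w : ℂ, w ≠ 0 → ‖w‖ ≤ 2 → ‖branch q w‖ ≤ C * ‖w‖ ^ (-s) := by
  have hβ' : 0 < β.toReal := ENNReal.toReal_pos hβ.ne' hβq.ne_top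
  unfold branch
  split_ifs with hq
  · set s : ℝ := (2 * β.toReal)⁻¹ with hs
    have hs0 : 0 < s := by positivity
    refine ⟨s, (1 + Real.pi) * 2 ^ s + s⁻¹, hs0.le, by positivity, ?_, fun w hw hw2 => ?_⟩
    · rw [hs, mul_inv, mul_assoc, inv_mul_cancel₀ hβ'.ne']; norm_num
    have hx : 0 < ‖w‖ := norm_pos_iff.2 hw
    have h1 : 1 ≤ 2 ^ s * ‖w‖ ^ (-s) := by
      rw [Real.rpow_neg hx.le, ← Real.inv_rpow hx.le, ← Real.mul_rpow two_pos.le (by positivity)]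
      refine Real.one_le_rpow ?_ hs0.le
      rw [← div_eq_mul_inv, one_le_div hx]; exact hw2
    have h2 : |Real.log ‖w‖| ≤ 1 + s⁻¹ * ‖w‖ ^ (-s) := by
      have h3 := Real.log_le_sub_one_of_pos hx
      have h4 := Real.log_le_rpow_div (inv_pos.2 hx).le hs0
      rw [Real.log_inv, Real.inv_rpow hx.le, ← Real.rpow_neg hx.le, div_eq_inv_mul] at h4
      have h5 : 0 ≤ s⁻¹ * ‖w‖ ^ (-s) := by positivity
      rw [abs_le]; constructor <;> linarith
    have h3 := Complex.norm_le_abs_re_add_abs_im (Complex.log w)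
    rw [Complex.log_re, Complex.log_im] at h3
    have h4 := Complex.abs_arg_le_pi w
    have h5 := mul_le_mul_of_nonneg_left h1 (by positivity : 0 ≤ 1 + Real.pi)
    linarith
  · have hq0 : 0 < q.toReal := ENNReal.toReal_pos (hβ.trans hβq).ne' hq
    refine ⟨q.toReal⁻¹, 1, by positivity, zero_le_one, ?_, fun w hw _ => ?_⟩
    · rw [inv_mul_lt_iff₀ hq0, mul_one]
      exact (ENNReal.toReal_lt_toReal hβq.ne_top hq).2 hβq
    · rw [Complex.norm_cpow_real, one_mul]

/-- The argument of `branch q` in `peak q t` at the point `r e^{iθ}`. -/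
lemma peak_circlePt (q : ℝ≥0∞) (t : ℝ) (r : Ioo (0 : ℝ) 1) (θ : ℝ) :
    peak q t (circlePt r θ) =
      branch q (1 - (r : ℝ) * Complex.exp ((θ - t : ℝ) * Complex.I)) := by
  have : ((circlePt r θ : 𝔻) : ℂ) = (r : ℝ) * Complex.exp (θ * Complex.I) := rfl
  rw [peak, this, mul_left_comm, ← Complex.exp_add]
  congr 4
  push_cast; ring

lemma sq_norm_one_sub (r φ : ℝ) :
    ‖1 - (r : ℂ) * Complex.exp (φ * Complex.I)‖ ^ 2 = 1 - 2 * r * Real.cos φ + r ^ 2 := by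
  rw [Complex.sq_norm, Complex.normSq_apply]
  simp only [Complex.sub_re, Complex.one_re, Complex.re_ofReal_mul, Complex.exp_ofReal_mul_I_re,
    Complex.sub_im, Complex.one_im, Complex.im_ofReal_mul, Complex.exp_ofReal_mul_I_im]
  linear_combination r ^ 2 * Real.sin_sq_add_cos_sq φ

/-- |sin φ| is the distance from 1 to the real line spanned by e^{iφ}; being independent of r, it
yields a majorant valid for all radii. -/
lemma abs_sin_le_norm_one_sub (r φ : ℝ) :
    |Real.sin φ| ≤ ‖1 - (r : ℂ) * Complex.exp (φ * Complex.I)‖ := by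
  refine abs_le_of_sq_le_sq ?_ (norm_nonneg _)
  rw [sq_norm_one_sub]
  nlinarith [sq_nonneg (Real.cos φ - r), Real.sin_sq_add_cos_sq φ]

lemma norm_one_sub_le {r : ℝ} (hr0 : 0 ≤ r) (hr1 : r ≤ 1) (φ : ℝ) :
    ‖1 - (r : ℂ) * Complex.exp (φ * Complex.I)‖ ≤ (1 - r) + |φ| := by
  refine le_of_sq_le_sq ?_ (by positivity [sub_nonneg.2 hr1])
  rw [sq_norm_one_sub]
  nlinarith [sq_abs φ, mul_nonneg (sub_nonneg.2 hr1) (abs_nonneg φ), sq_nonneg φ,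
    mul_le_mul_of_nonneg_left (Real.one_sub_sq_div_two_le_cos (x := φ)) hr0,
    mul_nonneg (sub_nonneg.2 hr1) (sq_nonneg φ)]

lemma norm_one_sub_le_two (r : Ioo (0 : ℝ) 1) (φ : ℝ) :
    ‖1 - ((r : ℝ) : ℂ) * Complex.exp (φ * Complex.I)‖ ≤ 2 := by
  refine (norm_sub_le _ _).trans ?_
  rw [norm_mul, Complex.norm_exp_ofReal_mul_I, norm_one, mul_one, Complex.norm_real,
    Real.norm_eq_abs, abs_of_pos r.2.1]
  linarith [r.2.2]

lemma one_sub_ne_zero (r : Ioo (0 : ℝ) 1) (φ : ℝ) :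
    1 - ((r : ℝ) : ℂ) * Complex.exp (φ * Complex.I) ≠ 0 := by
  intro h
  have := re_one_sub_pos (w := ((r : ℝ) : ℂ) * Complex.exp (φ * Complex.I)) (by
    rw [norm_mul, Complex.norm_exp_ofReal_mul_I, mul_one, Complex.norm_real,
      Real.norm_eq_abs, abs_of_pos r.2.1]
    exact r.2.2)
  simp [h] at this

/-! ### Uniform bounds in H^β for β < q -/

/-- By periodicity one period around 0 suffices, and there |sin x| ≥ (2/π)|x|. -/
lemma intervalIntegrable_abs_sin_rpow {σ : ℝ} (hσ0 : 0 ≤ σ) (hσ : σ < 1) (u v : ℝ) :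
    IntervalIntegrable (fun x => |Real.sin x| ^ (-σ)) volume u v := by
  have hper : Function.Periodic (fun x => |Real.sin x| ^ (-σ)) Real.pi := fun x => by
    simp [Real.sin_add_pi]
  refine hper.intervalIntegrable Real.pi_pos.ne' (t := -(Real.pi / 2)) ?_ u v
  have hx : ∀ c, IntervalIntegrable (fun x : ℝ => |x| ^ (-σ)) volume 0 c := by
    have hpos : ∀ c : ℝ, 0 ≤ c → IntervalIntegrable (fun x : ℝ => |x| ^ (-σ)) volume 0 c := by
      intro c hc
      refine (intervalIntegral.intervalIntegrable_rpow' (r := -σ) (by linarith)).congr ?_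
      intro x hx
      rw [uIoc_of_le hc] at hx
      simp only [abs_of_pos hx.1]
    intro c
    rcases le_total 0 c with hc | hc
    · exact hpos c hc
    · simpa using (IntervalIntegrable.iff_comp_neg (a := 0) (b := -c)).1 (hpos (-c) (by linarith))
  have hx2 : IntervalIntegrable (fun x : ℝ => (2 / Real.pi) ^ (-σ) * |x| ^ (-σ)) volume
      (-(Real.pi / 2)) (-(Real.pi / 2) + Real.pi) :=
    ((hx _).symm.trans (hx _)).const_mul _
  refine hx2.mono_fun (Measurable.aestronglyMeasurable (by fun_prop)) ?_
  rw [uIoc_of_le (by linarith [Real.pi_pos])]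
  filter_upwards [ae_restrict_mem measurableSet_Ioc] with x hx'
  have hxa : |x| ≤ Real.pi / 2 := abs_le.2 ⟨hx'.1.le, by linarith [hx'.2]⟩
  rw [Real.norm_of_nonneg (by positivity), Real.norm_of_nonneg (by positivity),
    ← Real.mul_rpow (by positivity) (abs_nonneg x)]
  rcases eq_or_ne x 0 with rfl | hne
  · simp
  · exact Real.rpow_le_rpow_of_nonpos (by positivity) (Real.mul_abs_le_abs_sin hxa) (by linarith)

/-- The functions `peak q t`, for `t` in a bounded set, are uniformly bounded in `H^β`, `β < q`. -/
lemma exists_sectorSize_peak_le {q β : ℝ≥0∞} (hβ : 0 < β) (hβq : β < q) (a b : ℝ) :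
    ∃ K : ℝ≥0∞, K < ∞ ∧
      ∀ t ∈ Icc a b, sectorSize β 0 (2 * Real.pi) (peak q t) ≤ K := by
  obtain ⟨s, C, hs, hC, hsβ, hbd⟩ := exists_branch_bound hβ hβq
  have hβ' : 0 < β.toReal := ENNReal.toReal_pos hβ.ne' hβq.ne_top
  set G : ℝ → ℝ≥0∞ := fun φ => ENNReal.ofReal (|Real.sin φ| ^ (-(s * β.toReal))) with hG
  have hGm : Measurable G := by fun_prop
  -- This window contains θ - t for all θ in [0, 2π] and t in [a, b], which makes the bound uniform
  -- in t.
  have hGfin : ∫⁻ φ in Icc (-b) (2 * Real.pi - a), G φ < ∞ := by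
    rcases le_total (-b) (2 * Real.pi - a) with h | h
    · have := ((intervalIntegrable_iff_integrableOn_Icc_of_le h).1
        (intervalIntegrable_abs_sin_rpow (by positivity) hsβ (-b) (2 * Real.pi - a))).2
      refine lt_of_eq_of_lt (lintegral_congr fun φ => ?_) this
      rw [hG, Real.enorm_of_nonneg (by positivity)]
    · refine lt_of_le_of_lt (le_of_eq (setLIntegral_measure_zero _ _ ?_)) ENNReal.zero_lt_top
      simp only [Real.volume_Icc, ENNReal.ofReal_eq_zero]
      linarith
  refine ⟨ENNReal.ofReal (C ^ β.toReal) * ∫⁻ φ in Icc (-b) (2 * Real.pi - a), G φ,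
    ENNReal.mul_lt_top ENNReal.ofReal_lt_top hGfin, fun t ht => ?_⟩
  rw [sectorSize, if_neg hβq.ne_top]
  refine iSup_le fun r => ?_
  -- Zeros of the sine are discarded: a negative power of 0 takes the value 0 and would not
  -- majorize.
  have hae : ∀ᵐ θ : ℝ, Real.sin (θ - t) ≠ 0 := by
    have hc : (range fun n : ℤ => n * Real.pi + t).Countable := countable_range _
    filter_upwards [hc.ae_notMem volume] with θ hθ h
    obtain ⟨n, hn⟩ := Real.sin_eq_zero_iff.1 h
    exact hθ ⟨n, by simp [hn]⟩
  calc ∫⁻ θ in Icc 0 (2 * Real.pi), ‖peak q t (circlePt r θ)‖ₑ ^ β.toReal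
      ≤ ∫⁻ θ in Icc 0 (2 * Real.pi), ENNReal.ofReal (C ^ β.toReal) * G (θ - t) := by
        refine lintegral_mono_ae ?_
        filter_upwards [ae_restrict_of_ae hae] with θ hθ
        have h1 : ‖peak q t (circlePt r θ)‖ ≤ C * |Real.sin (θ - t)| ^ (-s) := by
          rw [peak_circlePt]
          refine (hbd _ (one_sub_ne_zero r _) (norm_one_sub_le_two r _)).trans ?_
          refine mul_le_mul_of_nonneg_left ?_ hC
          exact Real.rpow_le_rpow_of_nonpos (abs_pos.2 hθ) (abs_sin_le_norm_one_sub _ _)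
            (by linarith)
        rw [hG, ← ENNReal.ofReal_mul (by positivity), ← ofReal_norm,
          ENNReal.ofReal_rpow_of_nonneg (norm_nonneg _) hβ'.le]
        refine ENNReal.ofReal_le_ofReal ((Real.rpow_le_rpow (norm_nonneg _) h1 hβ'.le).trans_eq ?_)
        rw [Real.mul_rpow hC (by positivity), ← Real.rpow_mul (abs_nonneg _), neg_mul]
    _ = ENNReal.ofReal (C ^ β.toReal) * ∫⁻ θ in Icc 0 (2 * Real.pi), G (θ - t) :=
        lintegral_const_mul _ (by fun_prop)
    _ ≤ _ := by
        refine mul_le_mul_right ?_ _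
        rw [← lintegral_indicator measurableSet_Icc, ← lintegral_indicator measurableSet_Icc,
          ← lintegral_sub_right_eq_self (indicator _ G) t]
        refine lintegral_mono fun θ => indicator_le (g := fun θ => indicator _ G (θ - t)) (fun x hx => ?_) θ
        rw [indicator_of_mem]
        exact ⟨by linarith [hx.1, ht.2], by linarith [hx.2, ht.1]⟩

lemma peak_mem_hardy {q β : ℝ≥0∞} (hβ : 0 < β) (hβq : β < q) (t : ℝ) : peak q t ∈ hardy β := by
  obtain ⟨K, hK, h⟩ := exists_sectorSize_peak_le hβ hβq t t
  exact ⟨peak_mem_holo q t, (h t (by simp)).trans_lt hK⟩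

/-! ### Behaviour on sectors and independence modulo H^q_{[a,b]} -/

lemma localHardy_mono {q : ℝ≥0∞} {a b a' b' : ℝ} (h : Icc a' b' ⊆ Icc a b) :
    localHardy q a b ≤ localHardy q a' b' := by
  rintro f ⟨hf, hf'⟩
  refine ⟨hf, lt_of_le_of_lt ?_ hf'⟩
  unfold sectorSize
  split_ifs
  · exact iSup_mono fun r => biSup_mono fun θ hθ => h hθ
  · exact iSup_mono fun r => lintegral_mono_set h

lemma mem_localHardy_of_bounded {q : ℝ≥0∞} {a b : ℝ} {f : 𝔻 → ℂ} (hf : f ∈ holo) {M : ℝ}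
    (hM : ∀ r, ∀ θ ∈ Icc a b, ‖f (circlePt r θ)‖ ≤ M) : f ∈ localHardy q a b := by
  have hM' : ∀ r, ∀ θ ∈ Icc a b, ‖f (circlePt r θ)‖ₑ ≤ ENNReal.ofReal M := fun r θ hθ => by
    rw [← ofReal_norm]
    exact ENNReal.ofReal_le_ofReal (hM r θ hθ)
  refine ⟨hf, ?_⟩
  unfold sectorSize
  split_ifs
  · exact (iSup_le fun r => iSup₂_le fun θ hθ => hM' r θ hθ).trans_lt ENNReal.ofReal_lt_top
  · refine lt_of_le_of_lt (b := ENNReal.ofReal M ^ q.toReal * volume (Icc a b)) ?_ ?_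
    · refine iSup_le fun r => ?_
      rw [← setLIntegral_const]
      exact setLIntegral_mono measurable_const fun θ hθ =>
        ENNReal.rpow_le_rpow (hM' r θ hθ) ENNReal.toReal_nonneg
    · refine ENNReal.mul_lt_top ?_ (by simp)
      exact ENNReal.rpow_lt_top_of_nonneg ENNReal.toReal_nonneg ENNReal.ofReal_ne_top

/-- The sine majorant is continuous on the compact interval, hence bounded. It also blows up at the
antipode of e^{it}, which costs nothing on arcs of length at most π. -/
lemma peak_mem_localHardy_of_sin_ne_zero {q : ℝ≥0∞} (hq : 0 < q) {t a b : ℝ}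
    (h : ∀ θ ∈ Icc a b, Real.sin (θ - t) ≠ 0) : peak q t ∈ localHardy q a b := by
  obtain ⟨β, hβ, hβq⟩ := exists_between hq
  obtain ⟨s, C, hs, hC, -, hbd⟩ := exists_branch_bound hβ hβq
  have hcont : ContinuousOn (fun θ => C * |Real.sin (θ - t)| ^ (-s)) (Icc a b) := by
    refine continuousOn_const.mul (ContinuousOn.rpow_const (by fun_prop) fun θ hθ => Or.inl ?_)
    exact abs_ne_zero.2 (h θ hθ)
  obtain ⟨M, hM⟩ := isCompact_Icc.exists_bound_of_continuousOn hcont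
  refine mem_localHardy_of_bounded (peak_mem_holo q t) (M := M) fun r θ hθ => ?_
  refine le_trans ?_ ((le_abs_self _).trans (hM θ hθ))
  rw [peak_circlePt]
  refine (hbd _ (one_sub_ne_zero r _) (norm_one_sub_le_two r _)).trans ?_
  refine mul_le_mul_of_nonneg_left ?_ hC
  exact Real.rpow_le_rpow_of_nonpos (abs_pos.2 (h θ hθ)) (abs_sin_le_norm_one_sub _ _)
    (by linarith)

/-- The radii `1 - 1 / (n + 2)`. -/
noncomputable def radius (n : ℕ) : Ioo (0 : ℝ) 1 :=
  ⟨1 - ((n : ℝ) + 2)⁻¹, by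
    have h : 1 < (n : ℝ) + 2 := by linarith [n.cast_nonneg (α := ℝ)]
    have h1 := inv_lt_one_of_one_lt₀ h
    have h2 : 0 < ((n : ℝ) + 2)⁻¹ := by positivity
    constructor <;> linarith⟩

lemma tendsto_one_sub_radius : Tendsto (fun n => 1 - (radius n : ℝ)) atTop (𝓝 0) := by
  simp only [radius, sub_sub_cancel]
  exact tendsto_inv_atTop_zero.comp
    (tendsto_atTop_add_const_right _ _ tendsto_natCast_atTop_atTop)

/-- For q = ∞ the logarithm blows up along the radius to e^{it}. For finite q, |peak|^q is at least
1/((1 - r) + |θ - t|), and Fatou as r → 1 would make 1/|θ - t| integrable near t. -/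
lemma peak_notMem_localHardy {q : ℝ≥0∞} (hq : 0 < q) (t : ℝ) {δ : ℝ} (hδ : 0 < δ) :
    peak q t ∉ localHardy q (t - δ) (t + δ) := by
  rintro ⟨-, h⟩
  rcases eq_or_ne q ∞ with rfl | hqt
  · rw [sectorSize, if_pos rfl] at h
    have hle : ∀ n, -Real.log (1 - radius n) ≤
        (⨆ r : Ioo (0 : ℝ) 1, ⨆ θ ∈ Icc (t - δ) (t + δ), ‖peak ∞ t (circlePt r θ)‖ₑ).toReal := by
      intro n
      have h1 : ‖peak ∞ t (circlePt (radius n) t)‖ₑ ≤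
          ⨆ r : Ioo (0 : ℝ) 1, ⨆ θ ∈ Icc (t - δ) (t + δ), ‖peak ∞ t (circlePt r θ)‖ₑ :=
        le_iSup_of_le (radius n) (le_iSup₂_of_le t ⟨by linarith, by linarith⟩ le_rfl)
      have h2 := ENNReal.toReal_mono h.ne h1
      rw [toReal_enorm, peak_circlePt, branch, if_pos rfl] at h2
      refine le_trans ?_ ((Complex.abs_re_le_norm _).trans h2)
      rw [Complex.log_re]
      refine le_trans (le_of_eq ?_) (neg_le_abs _)
      rw [sub_self, Complex.ofReal_zero, zero_mul, Complex.exp_zero, mul_one,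
        ← Complex.ofReal_one, ← Complex.ofReal_sub, Complex.norm_real, Real.norm_eq_abs,
        Real.log_abs]
    have htop : Tendsto (fun n => -Real.log (1 - radius n)) atTop atTop := by
      refine tendsto_neg_atBot_atTop.comp (Real.tendsto_log_nhdsGT_zero.comp ?_)
      exact tendsto_nhdsWithin_iff.2 ⟨tendsto_one_sub_radius,
        Eventually.of_forall fun n => sub_pos.2 (radius n).2.2⟩
    obtain ⟨n, hn⟩ := (htop.eventually_gt_atTop _).exists
    exact absurd (hle n) (not_le.2 hn)
  · rw [sectorSize, if_neg hqt] at h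
    have hq0 : 0 < q.toReal := ENNReal.toReal_pos hq.ne' hqt
    set F : ℕ → ℝ → ℝ≥0∞ :=
      fun n θ => ENNReal.ofReal (((1 - (radius n : ℝ)) + |θ - t|)⁻¹) with hF
    have hFle : ∀ n, ∫⁻ θ in Icc (t - δ) (t + δ), F n θ ≤
        ⨆ r : Ioo (0 : ℝ) 1, ∫⁻ θ in Icc (t - δ) (t + δ),
          ‖peak q t (circlePt r θ)‖ₑ ^ q.toReal := by
      intro n
      refine le_iSup_of_le (radius n) (lintegral_mono fun θ => ?_)
      rw [hF, peak_circlePt, branch, if_neg hqt, ← ofReal_norm, Complex.norm_cpow_real,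
        ENNReal.ofReal_rpow_of_nonneg (by positivity) hq0.le, ← Real.rpow_mul (norm_nonneg _),
        neg_mul, inv_mul_cancel₀ hq0.ne', Real.rpow_neg_one]
      refine ENNReal.ofReal_le_ofReal (inv_anti₀ (norm_pos_iff.2 (one_sub_ne_zero _ _)) ?_)
      exact norm_one_sub_le (radius n).2.1.le (radius n).2.2.le _
    have hlim : ∫⁻ θ in Icc (t - δ) (t + δ), ENNReal.ofReal (|θ - t|⁻¹) < ∞ := by
      refine lt_of_le_of_lt ?_ h
      refine le_trans ?_ ((lintegral_liminf_le (μ := volume.restrict (Icc (t - δ) (t + δ)))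
        (f := F) (u := atTop) fun n => by fun_prop).trans
        (liminf_le_of_frequently_le' (Eventually.of_forall hFle).frequently))
      refine lintegral_mono_ae (ae_restrict_of_ae ?_)
      filter_upwards [Measure.ae_ne volume t] with θ hθ
      refine le_of_eq (Tendsto.liminf_eq ?_).symm
      refine ENNReal.tendsto_ofReal (Tendsto.inv₀ ?_ (abs_ne_zero.2 (sub_ne_zero.2 hθ)))
      simpa using tendsto_one_sub_radius.add_const |θ - t|
    have hint : IntervalIntegrable (fun θ => (θ - t)⁻¹) volume (t - δ) (t + δ) := by
      rw [intervalIntegrable_iff_integrableOn_Icc_of_le (by linarith)]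
      refine ⟨Measurable.aestronglyMeasurable (by fun_prop),
        lt_of_eq_of_lt (lintegral_congr fun θ => ?_) hlim⟩
      rw [← ofReal_norm, Real.norm_eq_abs, abs_inv]
    rw [intervalIntegrable_sub_inv_iff] at hint
    rcases hint with h' | h'
    · linarith
    · exact h' (by rw [uIcc_of_le (by linarith)]; constructor <;> linarith)

/-- Nontrivial linear combinations of `peak q t`, with `t` in an interval of length at most `π`
inside `[a, b]`, are not in `H^q_{[a,b]}`. -/
lemma eq_zero_of_sum_peak_mem {q : ℝ≥0∞} (hq : 0 < q) {a b c : ℝ} (hcb : c ≤ b)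
    (hca : c ≤ a + Real.pi) (l : Ioo a c →₀ ℂ)
    (hl : Finsupp.linearCombination ℂ (fun t : Ioo a c => peak q t) l ∈ localHardy q a b) :
    l = 0 := by
  classical
  by_contra hne
  obtain ⟨t, ht⟩ := Finsupp.support_nonempty_iff.2 hne
  -- Choose a sector around one singularity `t` of the combination that excludes all the others;
  -- there the other terms are bounded.
  have hev : ∀ᶠ δ in 𝓝[>] (0 : ℝ), 0 < δ ∧ Icc ((t : ℝ) - δ) (t + δ) ⊆ Ioo a c ∧
      ∀ s ∈ l.support.erase t, δ < |(s : ℝ) - t| := by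
    have hlt : ∀ x : ℝ, 0 < x → ∀ᶠ δ in 𝓝[>] (0 : ℝ), δ < x := fun x hx =>
      eventually_nhdsWithin_of_eventually_nhds (eventually_lt_nhds hx)
    refine eventually_mem_nhdsWithin.and (Eventually.and ?_ ?_)
    · filter_upwards [hlt _ (sub_pos.2 t.2.1), hlt _ (sub_pos.2 t.2.2)] with δ h1 h2 θ hθ
      exact ⟨by linarith [hθ.1], by linarith [hθ.2]⟩
    · rw [Filter.eventually_all_finset]
      intro s hs
      refine hlt _ (abs_pos.2 (sub_ne_zero.2 fun h => ?_))
      exact (Finset.mem_erase.1 hs).1 (Subtype.ext h)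
  obtain ⟨δ, hδ, hsub, hsep⟩ := hev.exists
  have hmem := localHardy_mono (q := q)
    (hsub.trans (Ioo_subset_Icc_self.trans (Icc_subset_Icc_right hcb))) hl
  rw [Finsupp.linearCombination_apply, Finsupp.sum, ← Finset.add_sum_erase _ _ ht] at hmem
  have hrest : ∑ s ∈ l.support.erase t, l s • peak q s ∈ localHardy q (t - δ) (t + δ) := by
    refine Submodule.sum_mem _ fun s hs => Submodule.smul_mem _ _ ?_
    refine peak_mem_localHardy_of_sin_ne_zero hq fun θ hθ hsin => ?_
    -- Both θ and s lie in an interval of length at most π, so the sine can vanish only at θ = s.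
    have hθ' := hsub hθ
    have h0 := (Real.sin_eq_zero_iff_of_lt_of_lt (by linarith [hθ'.1, s.2.2])
      (by linarith [hθ'.2, s.2.1])).1 hsin
    have h1 := hsep s hs
    rw [← sub_eq_zero.1 h0] at h1
    exact absurd h1 (not_lt.2 (abs_le.2 ⟨by linarith [hθ.1], by linarith [hθ.2]⟩))
  have h2 := (Submodule.add_mem_iff_left _ hrest).1 hmem
  exact peak_notMem_localHardy hq t hδ
    ((Submodule.smul_mem_iff _ (Finsupp.mem_support_iff.1 ht)).1 h2)

/-! ### Convergence in the Hardy topologies and assembly -/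

/-- Scaling by c multiplies `sectorSize` by |c|^p, so a family of bounded size divided by n + 1
tends to zero. -/
lemma tendsto_hardy {p : ℝ≥0∞} (hp : 0 < p) (hpt : p ≠ ∞) {K : ℝ≥0∞} (hK : K < ∞) (f : hardy p)
    (g : ℕ → hardy p) (hg : ∀ n, sectorSize p 0 (2 * Real.pi) (g n) ≤ K) :
    @Tendsto _ _ (fun n : ℕ => f + ((n : ℂ) + 1)⁻¹ • g n) atTop (@nhds _ (hardyTopology p hp) f) := by
  let _ := hardyMetric p hp
  have hm : (0 : ℝ) < (max 1 p.toReal)⁻¹ := inv_pos.2 (lt_of_lt_of_le one_pos (le_max_left _ _))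
  have hp0 : 0 < p.toReal := ENNReal.toReal_pos hp.ne' hpt
  refine tendsto_iff_edist_tendsto_0.2 ?_
  have hle : ∀ n : ℕ, edist (f + ((n : ℂ) + 1)⁻¹ • g n) f ≤
      (‖((n : ℂ) + 1)⁻¹‖ₑ ^ p.toReal * K) ^ (max 1 p.toReal)⁻¹ := by
    intro n
    change hardyDist p _ _ ≤ _
    refine ENNReal.rpow_le_rpow ?_ hm.le
    have hc : ‖((n : ℂ) + 1)⁻¹‖ₑ ^ p.toReal ≠ ∞ :=
      ENNReal.rpow_ne_top_of_nonneg hp0.le enorm_ne_top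
    refine le_trans (le_of_eq ?_) (mul_le_mul_right (hg n) _)
    simp only [sectorSize, if_neg hpt, Submodule.coe_add, Submodule.coe_smul, add_sub_cancel_left,
      Pi.smul_apply, enorm_smul, ENNReal.mul_rpow_of_nonneg _ _ hp0.le,
      lintegral_const_mul' _ _ hc, ← ENNReal.mul_iSup]
  refine tendsto_of_tendsto_of_tendsto_of_le_of_le tendsto_const_nhds ?_ (fun _ => zero_le) hle
  have h1 : Tendsto (fun n : ℕ => ‖((n : ℂ) + 1)⁻¹‖ₑ) atTop (𝓝 0) := by
    have h := (tendsto_one_div_add_atTop_nhds_zero_nat (𝕜 := ℂ)).enorm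
    simpa using h
  have h2 := ENNReal.Tendsto.mul_const (b := K)
    ((ENNReal.continuous_rpow_const (y := p.toReal)).tendsto 0 |>.comp h1) (Or.inr hK.ne)
  have h3 := ((ENNReal.continuous_rpow_const (y := (max 1 p.toReal)⁻¹)).tendsto _).comp h2
  simpa [Function.comp_def, ENNReal.zero_rpow_of_pos hp0, ENNReal.zero_rpow_of_pos hm] using h3

/-- The dense-subspace construction for a space `H` of holomorphic functions that contains the
functions `peak q t` and in whose topology they form a bounded family. -/
lemma exists_dense_subspace {q : ℝ≥0∞} (hq : 0 < q) {a b : ℝ} (hab : a < b)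
    (H : Submodule ℂ (𝔻 → ℂ)) [TopologicalSpace H] (hH : H ≤ holo) (hpeak : ∀ t, peak q t ∈ H)
    (hlim : ∀ (f : H) (t : ℕ → ℝ), (∀ n, t n ∈ Icc a b) →
      Tendsto (fun n : ℕ => f + ((n : ℂ) + 1)⁻¹ • (⟨peak q (t n), hpeak _⟩ : H)) atTop (𝓝 f)) :
    ∃ V : Submodule ℂ H, (V : Set H) ⊆ {f | (f : 𝔻 → ℂ) ∉ localHardy q a b} ∪ {0} ∧
      Dense (V : Set H) := by
  classical
  set c := min b (a + Real.pi)
  have hac : a < c := lt_min hab (by linarith [Real.pi_pos])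
  have hcb : c ≤ b := min_le_left _ _
  obtain ⟨φ⟩ := exists_embedding_Ioo H hH hac
  have hind : ∀ l : (H × ℕ) →₀ ℂ,
      Finsupp.linearCombination ℂ (fun i => (⟨peak q (φ i), hpeak _⟩ : H)) l ∈
        (localHardy q a b).comap H.subtype → l = 0 := by
    intro l hl
    have h1 : l.embDomain φ = 0 := by
      refine eq_zero_of_sum_peak_mem hq hcb (min_le_right _ _) _ ?_
      rw [Finsupp.linearCombination_embDomain]
      rw [Submodule.mem_comap, Finsupp.apply_linearCombination] at hl
      exact hl
    exact Finsupp.embDomain_eq_zero.1 h1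
  obtain ⟨V, hV, hd⟩ := exists_dense_disjoint _ _ hind
    (fun f y => hlim f _ fun n => ⟨(φ (y, n)).2.1.le, (φ (y, n)).2.2.le.trans hcb⟩)
  refine ⟨V, fun f hf => ?_, hd⟩
  by_cases h : (f : 𝔻 → ℂ) ∈ localHardy q a b
  · exact Or.inr (Submodule.disjoint_def.1 hV f hf h)
  · exact Or.inl h

end HardyChain

open HardyChain
theorem theoremB (p q : ℝ≥0∞) (hp : 0 < p) (hpq : p ≤ q) (a b : ℝ) (hab : a < b) :
    (∃ V : Submodule ℂ (hardyInter p),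
      (V : Set (hardyInter p)) ⊆ {f | (f : 𝔻 → ℂ) ∉ localHardy q a b} ∪ {0} ∧
      @Dense (hardyInter p) (hardyInterTopology p) (V : Set (hardyInter p))) ∧
    (p < q → ∃ V : Submodule ℂ (hardy p),
      (V : Set (hardy p)) ⊆ {f | (f : 𝔻 → ℂ) ∉ localHardy q a b} ∪ {0} ∧
      @Dense (hardy p) (hardyTopology p hp) (V : Set (hardy p))) := by
  have hq : 0 < q := hp.trans_le hpq
  refine ⟨?_, fun hlt => ?_⟩
  · let _ := hardyInterTopology p
    refine exists_dense_subspace hq hab (hardyInter p) ?_ (fun t => ?_) fun f t ht => ?_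
    -- Some β is needed: holomorphy in the intersection is inherited from an actual H^β.
    · obtain ⟨β, hβ⟩ := exists_between hp
      exact (hardyInter_le p ⟨β, hβ⟩).trans fun f hf => hf.1
    · exact (Submodule.mem_iInf _).2 fun β => peak_mem_hardy β.2.1 (β.2.2.trans_le hpq) t
    · rw [nhds_iInf, tendsto_iInf]
      intro β
      rw [@nhds_induced _ _ (hardyTopology β β.2.1), tendsto_comap_iff]
      obtain ⟨K, hK, hle⟩ := exists_sectorSize_peak_le β.2.1 (β.2.2.trans_le hpq) a b
      exact tendsto_hardy β.2.1 β.2.2.ne_top hK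
        (Submodule.inclusion (hardyInter_le p β) f)
        (fun n => ⟨peak q (t n), peak_mem_hardy β.2.1 (β.2.2.trans_le hpq) _⟩)
        fun n => hle _ (ht n)
  · let _ := hardyTopology p hp
    refine exists_dense_subspace hq hab (hardy p) (fun f hf => hf.1)
      (fun t => peak_mem_hardy hp hlt t) fun f t ht => ?_
    obtain ⟨K, hK, hle⟩ := exists_sectorSize_peak_le hp hlt a b
    exact tendsto_hardy hp hlt.ne_top hK f _ fun n => hle _ (ht n)
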